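/- Let $s\ge 1$ and let $r,n_0,\dots,n_{s-1}\ge 0$ be integers. Put $W=\mathbb C^r$, with standard basis $w_1,\dots,w_r$, and $V_i=\mathbb C^{n_i}$. A representation of the nested instantons quiver of numerical type $(r,n_0,\dots,n_{s-1})$ is a tuple $X=(B_1^i,B_2^i,I,J,F^i,G^i)$ with $B_1^i,B_2^i\in\mathrm{End}(V_i)$ $(0\le i\le s-1)$, $I\in\mathrm{Hom}(W,V_0)$, $J\in\mathrm{Hom}(V_0,W)$, $F^i\in\mathrm{Hom}(V_i,V_{i-1})$, $G^i\in\mathrm{Hom}(V_{i-1},V_i)$ $(1\le i\le s-1)$, satisfying $$[B_1^0,B_2^0]+IJ=0,\quad [B_1^i,B_2^i]=0\ (i>0),\quad B_{1,2}^{i-1}F^i=F^iB_{1,2}^i,\quad G^iB_{1,2}^{i-1}=B_{1,2}^iG^i,\quad F^iG^i=0,\quad JF^1=0,\quad G^1I=0 .$$ It is stable if every $F^i$ is injective and no proper subspace of $V_0$ contains $\mathrm{im}\,I$ and is preserved by $B_1^0$ and $B_2^0$. Let $\mathcal N(r,n_0,\dots,n_{s-1})$ be the moduli space of stable representations; its (closed)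 points are the orbits $[X]$ of stable representations under $\mathcal G=GL(V_0)\times\cdots\times GL(V_{s-1})$, which acts by change of basis. The torus $T=(\mathbb C^*)^2\times(\mathbb C^*)^r\ni t=(t_1,t_2,e)$ acts on it by $$(B_1^i,B_2^i,I,J,F^i,G^i)\mapsto(t_1B_1^i,\;t_2B_2^i,\;Ie^{-1},\;t_1t_2\,eJ,\;F^i,\;t_1t_2G^i),$$ where $e=\mathrm{diag}(e_1,\dots,e_r)$ acts on $W$. A coloured partition is an $r$-tuple $\boldsymbol\mu=(\mu^1,\dots,\mu^r)$ of Young diagrams (finite subsets of $\mathbb N^2$, $\mathbb N=\{0,1,\dots\}$, closed under decreasing coordinates). Put $|\boldsymbol\mu|=\sum_a|\mu^a|$, and write $(a,k,l)\in\boldsymbol\mu$ for $(k,l)\in\mu^a$; inclusion of coloured partitions is componentwise. **Proposition.** The $T$-fixed points of $\mathcal N(r,n_0,\dots,n_{s-1})$ are in bijection with the $s$-tuples of nested coloured partitions $$\boldsymbol\mu_1\subseteq\cdots\subseteq\boldsymbol\mu_{s-1}\subseteq\boldsymbol\mu_0,\qquad |\boldsymbol\mu_0|=n_0,\qquad |\boldsymbol\mu_i|=n_0-n_i\quad(i>0).$$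 The bijection is such that the following holds for every representative $X$ of a fixed point with associated tuple $(\boldsymbol\mu_i)_i$. There are a homomorphism $\lambda=(\lambda_0,\dots,\lambda_{s-1}):T\to\mathcal G$ with $\lambda(t)\cdot(t\cdot X)=X$ for all $t\in T$, and bases $\{v^i_b\}$ of the spaces $V_i$, where $b$ runs over the boxes of $\boldsymbol\mu_0$ if $i=0$ and over those of the skew diagram $\boldsymbol\mu_0\setminus\boldsymbol\mu_i$ if $i>0$, such that $$\lambda_i(t)\,v^i_{(a,k,l)}=e_a\,t_1^{-k}t_2^{-l}\,v^i_{(a,k,l)}$$ and, with $v^i_b:=0$ for all other $b$, $$B_1^iv^i_{(a,k,l)}=v^i_{(a,k+1,l)},\quad B_2^iv^i_{(a,k,l)}=v^i_{(a,k,l+1)},\quad Iw_a=v^0_{(a,0,0)},\quad F^iv^i_b=v^{i-1}_b,\quad J=0,\quad G^i=0,$$ where in the formulas for $B_1^i$, $B_2^i$ and $F^i$ the box on the left-hand side is one of the boxes indexing the basis of $V_i$. -/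

import Mathlib

/-! Nested instantons quiver: representations, stability, moduli space, torus action, and
nested coloured partitions. The quiver has `N + 1` nodes `V_0, …, V_N` and one framing node `W`. -/

namespace NestedInstantons

/-- The framing space `W` of dimension `r`, with its standard basis `w_a`. -/
abbrev W (r : ℕ) : Type := Fin r → ℂ

/-- The space `V_i` of dimension `n_i` at the node `i`. -/
abbrev V {N : ℕ} (n : Fin (N + 1) → ℕ) (i : Fin (N + 1)) : Type := Fin (n i) → ℂ

/-- A point of the vector space of data of numerical type `(r, n_0, …, n_N)`.
The maps between `V_{i+1}` and `V_i` are indexed by `i = 0, …, N - 1`: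
`F i : V_{i+1} → V_i` and `G i : V_i → V_{i+1}`. -/
@[ext]
structure Datum {N : ℕ} (r : ℕ) (n : Fin (N + 1) → ℕ) where
  B₁ : ∀ i : Fin (N + 1), V n i →ₗ[ℂ] V n i
  B₂ : ∀ i : Fin (N + 1), V n i →ₗ[ℂ] V n i
  I : W r →ₗ[ℂ] V n 0
  J : V n 0 →ₗ[ℂ] W r
  F : ∀ i : Fin N, V n i.succ →ₗ[ℂ] V n i.castSucc
  G : ∀ i : Fin N, V n i.castSucc →ₗ[ℂ] V n i.succ

variable {N r : ℕ} {n : Fin (N + 1) → ℕ}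

/-- The nested ADHM equations (the relations of the quiver). -/
structure Datum.SatisfiesRelations (X : Datum r n) : Prop where
  adhm : X.B₁ 0 ∘ₗ X.B₂ 0 - X.B₂ 0 ∘ₗ X.B₁ 0 + X.I ∘ₗ X.J = 0
  comm : ∀ i : Fin (N + 1), i ≠ 0 → X.B₁ i ∘ₗ X.B₂ i - X.B₂ i ∘ₗ X.B₁ i = 0
  BF₁ : ∀ i : Fin N, X.B₁ i.castSucc ∘ₗ X.F i - X.F i ∘ₗ X.B₁ i.succ = 0
  BF₂ : ∀ i : Fin N, X.B₂ i.castSucc ∘ₗ X.F i - X.F i ∘ₗ X.B₂ i.succ = 0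
  GB₁ : ∀ i : Fin N, X.G i ∘ₗ X.B₁ i.castSucc - X.B₁ i.succ ∘ₗ X.G i = 0
  GB₂ : ∀ i : Fin N, X.G i ∘ₗ X.B₂ i.castSucc - X.B₂ i.succ ∘ₗ X.G i = 0
  FG : ∀ i : Fin N, X.F i ∘ₗ X.G i = 0
  JF : ∀ h : 0 < N, X.J ∘ₗ X.F ⟨0, h⟩ = 0
  GI : ∀ h : 0 < N, X.G ⟨0, h⟩ ∘ₗ X.I = 0

/-- Stability: all the maps `V_{i+1} → V_i` are injective, and the ADHM datum at `V_0` is stable,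
i.e. no proper subspace of `V_0` contains the image of `I` and is preserved by both
endomorphisms. -/
structure Datum.IsStable (X : Datum r n) : Prop where
  injective : ∀ i : Fin N, Function.Injective (X.F i)
  adhm_stable : ∀ S : Submodule ℂ (V n 0), LinearMap.range X.I ≤ S →
    S.map (X.B₁ 0) ≤ S → S.map (X.B₂ 0) ≤ S → S = ⊤

variable (r n) in
/-- Stable representations of the nested instantons quiver. -/
def StableRep : Type := {X : Datum r n // X.SatisfiesRelations ∧ X.IsStable}

variable (n) in
/-- The gauge group `GL(V_0) × ⋯ × GL(V_N)`. -/
abbrev Gauge : Type := ∀ i : Fin (N + 1), V n i ≃ₗ[ℂ] V n i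

variable (r) in
/-- The torus `(ℂ^*)² × (ℂ^*)^r`; an element is `(t₁, t₂, (e_1, …, e_r))`. -/
abbrev Torus : Type := ℂˣ × ℂˣ × (Fin r → ℂˣ)

/-- The diagonal action of the framing torus `(ℂ^*)^r` on `W`. -/
def diagW (e : Fin r → ℂˣ) : W r →ₗ[ℂ] W r :=
  LinearMap.pi fun a => (e a : ℂ) • LinearMap.proj a

/-- The action of the gauge group on data. -/
def gaugeAct (g : Gauge n) (X : Datum r n) : Datum r n where
  B₁ i := (g i).toLinearMap ∘ₗ X.B₁ i ∘ₗ (g i).symm.toLinearMap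
  B₂ i := (g i).toLinearMap ∘ₗ X.B₂ i ∘ₗ (g i).symm.toLinearMap
  I := (g 0).toLinearMap ∘ₗ X.I
  J := X.J ∘ₗ (g 0).symm.toLinearMap
  F i := (g i.castSucc).toLinearMap ∘ₗ X.F i ∘ₗ (g i.succ).symm.toLinearMap
  G i := (g i.succ).toLinearMap ∘ₗ X.G i ∘ₗ (g i.castSucc).symm.toLinearMap

/-- The action of the torus on data:
`(B₁, B₂, I, J, F, G) ↦ (t₁ B₁, t₂ B₂, I e⁻¹, t₁ t₂ e J, F, t₁ t₂ G)`. -/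
def torusAct (t : Torus r) (X : Datum r n) : Datum r n where
  B₁ i := (t.1 : ℂ) • X.B₁ i
  B₂ i := (t.2.1 : ℂ) • X.B₂ i
  I := X.I ∘ₗ diagW t.2.2⁻¹
  J := ((t.1 : ℂ) * (t.2.1 : ℂ)) • (diagW t.2.2 ∘ₗ X.J)
  F i := X.F i
  G i := ((t.1 : ℂ) * (t.2.1 : ℂ)) • X.G i

instance : MulAction (Gauge n) (Datum r n) where
  smul := gaugeAct
  one_smul X := by
    change gaugeAct 1 X = X
    ext <;> rfl
  mul_smul g h X := by
    change gaugeAct (g * h) X = gaugeAct g (gaugeAct h X)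
    ext <;> rfl

theorem diagW_one : diagW (1 : Fin r → ℂˣ) = LinearMap.id := by
  apply LinearMap.ext
  intro w
  ext a
  simp [diagW]

theorem diagW_mul (e f : Fin r → ℂˣ) : diagW (e * f) = diagW e ∘ₗ diagW f := by
  apply LinearMap.ext
  intro w
  ext a
  simp [diagW, mul_assoc]

instance : MulAction (Torus r) (Datum r n) where
  smul := torusAct
  one_smul X := by
    change torusAct 1 X = X
    apply Datum.ext <;> simp [torusAct, diagW_one]
  mul_smul s t X := by
    change torusAct (s * t) X = torusAct s (torusAct t X)
    apply Datum.ext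
    · funext i; simp [torusAct, mul_smul]
    · funext i; simp [torusAct, mul_smul]
    · simp only [torusAct, Prod.snd_mul, mul_inv, LinearMap.comp_assoc]
      rw [mul_comm, diagW_mul]
    · apply LinearMap.ext
      intro v
      funext a
      simp [torusAct, diagW]
      ring
    · rfl
    · funext i
      simp only [torusAct, Prod.fst_mul, Prod.snd_mul, Units.val_mul, smul_smul]
      congr 1
      ring

theorem gauge_smul_def (g : Gauge n) (X : Datum r n) : g • X = gaugeAct g X := rfl

theorem torus_smul_def (t : Torus r) (X : Datum r n) : t • X = torusAct t X := rfl

theorem torus_gauge_comm (t : Torus r) (g : Gauge n) (X : Datum r n) :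
    t • g • X = g • t • X := by
  simp only [gauge_smul_def, torus_smul_def]
  apply Datum.ext
  · funext i; ext; simp [torusAct, gaugeAct]
  · funext i; ext; simp [torusAct, gaugeAct]
  · rfl
  · ext; simp [torusAct, gaugeAct]
  · rfl
  · funext i; ext; simp [torusAct, gaugeAct]

theorem gauge_relations (g : Gauge n) {X : Datum r n} (hX : X.SatisfiesRelations) :
    (g • X).SatisfiesRelations := by
  obtain ⟨h1, h2, h3, h4, h5, h6, h7, h8, h9⟩ := hX
  rw [gauge_smul_def]
  constructor
  · apply LinearMap.ext; intro v
    have := congrArg (g 0) (LinearMap.congr_fun h1 ((g 0).symm v))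
    simpa [gaugeAct] using this
  · intro i hi; apply LinearMap.ext; intro v
    have := congrArg (g i) (LinearMap.congr_fun (h2 i hi) ((g i).symm v))
    simpa [gaugeAct] using this
  · intro i; apply LinearMap.ext; intro v
    have := congrArg (g i.castSucc) (LinearMap.congr_fun (h3 i) ((g i.succ).symm v))
    simpa [gaugeAct] using this
  · intro i; apply LinearMap.ext; intro v
    have := congrArg (g i.castSucc) (LinearMap.congr_fun (h4 i) ((g i.succ).symm v))
    simpa [gaugeAct] using this
  · intro i; apply LinearMap.ext; intro v
    have := congrArg (g i.succ) (LinearMap.congr_fun (h5 i) ((g i.castSucc).symm v))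
    simpa [gaugeAct] using this
  · intro i; apply LinearMap.ext; intro v
    have := congrArg (g i.succ) (LinearMap.congr_fun (h6 i) ((g i.castSucc).symm v))
    simpa [gaugeAct] using this
  · intro i; apply LinearMap.ext; intro v
    have := congrArg (g i.castSucc) (LinearMap.congr_fun (h7 i) ((g i.castSucc).symm v))
    simpa [gaugeAct] using this
  · intro h; apply LinearMap.ext; intro v
    have e := LinearMap.congr_fun (h8 h) ((g (Fin.succ ⟨0, h⟩)).symm v)
    exact (congrArg X.J ((g 0).symm_apply_apply _)).trans e
  · intro h; apply LinearMap.ext; intro v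
    have e := LinearMap.congr_fun (h9 h) v
    have e' : X.G ⟨0, h⟩ ((g 0).symm ((g 0) (X.I v))) = 0 :=
      (congrArg (X.G ⟨0, h⟩) ((g 0).symm_apply_apply _)).trans e
    exact (congrArg (g (Fin.succ ⟨0, h⟩)) e').trans (map_zero _)

theorem gauge_stable (g : Gauge n) {X : Datum r n} (hX : X.IsStable) : (g • X).IsStable := by
  rw [gauge_smul_def]
  constructor
  · intro i
    exact (g i.castSucc).injective.comp ((hX.injective i).comp (g i.succ).symm.injective)
  · intro S hI h1 h2
    have key : S.comap (g 0).toLinearMap = ⊤ := by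
      apply hX.adhm_stable
      · rintro _ ⟨w, rfl⟩
        exact hI ⟨w, rfl⟩
      · rintro _ ⟨v, hv, rfl⟩
        have := h1 ⟨g 0 v, hv, rfl⟩
        simpa [gaugeAct] using this
      · rintro _ ⟨v, hv, rfl⟩
        have := h2 ⟨g 0 v, hv, rfl⟩
        simpa [gaugeAct] using this
    rw [eq_top_iff]
    intro v _
    have : (g 0).symm v ∈ S.comap (g 0).toLinearMap := by rw [key]; trivial
    simpa using this

theorem torus_relations (t : Torus r) {X : Datum r n} (hX : X.SatisfiesRelations) :
    (t • X).SatisfiesRelations := by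
  obtain ⟨h1, h2, h3, h4, h5, h6, h7, h8, h9⟩ := hX
  rw [torus_smul_def]
  have hd : diagW t.2.2⁻¹ ∘ₗ diagW t.2.2 = LinearMap.id := by
    rw [← diagW_mul, inv_mul_cancel, diagW_one]
  constructor
  · apply LinearMap.ext; intro v
    have e : diagW t.2.2⁻¹ (diagW t.2.2 (X.J v)) = X.J v := LinearMap.congr_fun hd _
    have e1 := congrArg (fun w => ((t.1 : ℂ) * (t.2.1 : ℂ)) • w) (LinearMap.congr_fun h1 v)
    simp only [LinearMap.add_apply, LinearMap.sub_apply, LinearMap.comp_apply,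
      LinearMap.zero_apply, smul_zero] at e1
    simp only [torusAct, LinearMap.add_apply, LinearMap.sub_apply, LinearMap.comp_apply,
      LinearMap.smul_apply, LinearMap.zero_apply, map_smul, e]
    rw [← e1]
    module
  · intro i hi
    have e := sub_eq_zero.1 (h2 i hi)
    rw [sub_eq_zero]
    simp only [torusAct, LinearMap.comp_smul, LinearMap.smul_comp, e]
    exact smul_comm _ _ _
  · intro i
    have e := sub_eq_zero.1 (h3 i)
    rw [sub_eq_zero]
    simp only [torusAct, LinearMap.comp_smul, LinearMap.smul_comp, e]
  · intro i
    have e := sub_eq_zero.1 (h4 i)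
    rw [sub_eq_zero]
    simp only [torusAct, LinearMap.comp_smul, LinearMap.smul_comp, e]
  · intro i
    have e := sub_eq_zero.1 (h5 i)
    rw [sub_eq_zero]
    simp only [torusAct, LinearMap.comp_smul, LinearMap.smul_comp, e]
    exact smul_comm _ _ _
  · intro i
    have e := sub_eq_zero.1 (h6 i)
    rw [sub_eq_zero]
    simp only [torusAct, LinearMap.comp_smul, LinearMap.smul_comp, e]
    exact smul_comm _ _ _
  · intro i
    simp only [torusAct, LinearMap.comp_smul, h7 i, smul_zero]
  · intro h; apply LinearMap.ext; intro v
    have e : X.J (X.F ⟨0, h⟩ v) = 0 := LinearMap.congr_fun (h8 h) v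
    change ((t.1 : ℂ) * (t.2.1 : ℂ)) • diagW t.2.2 (X.J (X.F ⟨0, h⟩ v)) = 0
    rw [e, map_zero, smul_zero]
  · intro h; apply LinearMap.ext; intro v
    have e : X.G ⟨0, h⟩ (X.I (diagW t.2.2⁻¹ v)) = 0 := LinearMap.congr_fun (h9 h) _
    change ((t.1 : ℂ) * (t.2.1 : ℂ)) • X.G ⟨0, h⟩ (X.I (diagW t.2.2⁻¹ v)) = 0
    rw [e, smul_zero]

theorem torus_stable (t : Torus r) {X : Datum r n} (hX : X.IsStable) : (t • X).IsStable := by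
  rw [torus_smul_def]
  have hd : diagW t.2.2⁻¹ ∘ₗ diagW t.2.2 = LinearMap.id := by
    rw [← diagW_mul, inv_mul_cancel, diagW_one]
  constructor
  · exact hX.injective
  · intro S hI h1 h2
    apply hX.adhm_stable
    · rintro _ ⟨w, rfl⟩
      refine hI ⟨diagW t.2.2 w, ?_⟩
      have := LinearMap.congr_fun hd w
      simp only [LinearMap.comp_apply, LinearMap.id_apply] at this
      simp [torusAct, this]
    · rintro _ ⟨v, hv, rfl⟩
      exact (S.smul_mem_iff t.1.ne_zero).1 (h1 ⟨v, hv, rfl⟩)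
    · rintro _ ⟨v, hv, rfl⟩
      exact (S.smul_mem_iff t.2.1.ne_zero).1 (h2 ⟨v, hv, rfl⟩)

instance : MulAction (Gauge n) (StableRep r n) where
  smul g X := ⟨g • X.1, gauge_relations g X.2.1, gauge_stable g X.2.2⟩
  one_smul X := Subtype.ext (one_smul _ X.1)
  mul_smul g h X := Subtype.ext (mul_smul g h X.1)

instance : MulAction (Torus r) (StableRep r n) where
  smul t X := ⟨t • X.1, torus_relations t X.2.1, torus_stable t X.2.2⟩
  one_smul X := Subtype.ext (one_smul _ X.1)
  mul_smul s t X := Subtype.ext (mul_smul s t X.1)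

theorem torus_gauge_comm_stable (t : Torus r) (g : Gauge n) (X : StableRep r n) :
    t • g • X = g • t • X := Subtype.ext (torus_gauge_comm t g X.1)

variable (r n) in
/-- The moduli space `N(r, n_0, …, n_N)` of nested instantons: the (closed) points are the
gauge orbits of stable representations. -/
def ModuliSpace : Type := MulAction.orbitRel.Quotient (Gauge n) (StableRep r n)

/-- The point of the moduli space represented by a stable representation. -/
def ModuliSpace.mk (X : StableRep r n) : ModuliSpace r n :=
  Quotient.mk (MulAction.orbitRel (Gauge n) (StableRep r n)) X

/-- The induced action of the torus on the moduli space. -/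
instance : MulAction (Torus r) (ModuliSpace r n) where
  smul t := Quotient.map (fun X : StableRep r n => t • X) (by
    rintro _ X ⟨g, rfl⟩
    exact ⟨g, (torus_gauge_comm_stable t g X).symm⟩)
  one_smul := by
    rintro ⟨X⟩
    exact congrArg ModuliSpace.mk (one_smul (Torus r) X)
  mul_smul s t := by
    rintro ⟨X⟩
    exact congrArg ModuliSpace.mk (mul_smul s t X)

variable (r n) in
/-- The torus-fixed locus of the moduli space. -/
abbrev FixedLocus : Set (ModuliSpace r n) := MulAction.fixedPoints (Torus r) (ModuliSpace r n)

/-- Size of a coloured partition (an `r`-tuple of Young diagrams). -/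
def colouredSize (μ : Fin r → YoungDiagram) : ℕ := ∑ a, (μ a).card

variable (r n) in
/-- Nested coloured partitions `μ_1 ⊆ ⋯ ⊆ μ_N ⊆ μ_0` with `|μ_0| = n_0` and
`|μ_i| = n_0 - n_i` for `i > 0`. -/
@[ext]
structure NestedPartition where
  part : Fin (N + 1) → Fin r → YoungDiagram
  nested : ∀ i j : Fin (N + 1), 0 < i → i ≤ j → part i ≤ part j
  nested_zero : ∀ i : Fin (N + 1), part i ≤ part 0
  size_zero : colouredSize (part 0) = n 0
  size : ∀ i : Fin (N + 1), 0 < i → (colouredSize (part i) : ℤ) = (n 0 : ℤ) - (n i : ℤ)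

/-- Boxes indexing a basis of `V_i`: all boxes of `μ_0` if `i = 0`, those of the skew diagram
`μ_0 ∖ μ_i` if `i > 0`. A box `(a, k, l)` is the box `(k, l)` (counted from `0`) of colour `a`. -/
def NestedPartition.boxes (μ : NestedPartition r n) (i : Fin (N + 1)) : Set (Fin r × ℕ × ℕ) :=
  {b | b.2 ∈ μ.part 0 b.1 ∧ (0 < i → b.2 ∉ μ.part i b.1)}

/-- The vectors `v i b`, for `b` a box of `μ_0` (if `i = 0`) or `μ_0 ∖ μ_i` (if `i > 0`), form a
basis of `V_i`, with `v i b = 0` for all other `b`, and in these bases `X` is the standard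
monomial representation attached to `μ`. -/
structure IsMonomialBasis (X : Datum r n) (μ : NestedPartition r n)
    (v : ∀ i : Fin (N + 1), Fin r × ℕ × ℕ → V n i) : Prop where
  linearIndependent : ∀ i, LinearIndependent ℂ (fun b : μ.boxes i => v i b)
  span : ∀ i, Submodule.span ℂ (v i '' μ.boxes i) = ⊤
  off : ∀ i, ∀ b ∉ μ.boxes i, v i b = 0
  B₁ : ∀ i a k l, (a, k, l) ∈ μ.boxes i → X.B₁ i (v i (a, k, l)) = v i (a, k + 1, l)
  B₂ : ∀ i a k l, (a, k, l) ∈ μ.boxes i → X.B₂ i (v i (a, k, l)) = v i (a, k, l + 1)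
  I : ∀ a, X.I (Pi.single a 1) = v 0 (a, 0, 0)
  J : X.J = 0
  F : ∀ i : Fin N, ∀ b ∈ μ.boxes i.succ, X.F i (v i.succ b) = v i.castSucc b
  G : ∀ i : Fin N, X.G i = 0

/-- The character `e_a t₁^{-k} t₂^{-l}` of the torus attached to the box `(a, k, l)`. -/
def boxWeight (t : Torus r) (b : Fin r × ℕ × ℕ) : ℂˣ :=
  t.2.2 b.1 * (t.1 ^ b.2.1)⁻¹ * (t.2.1 ^ b.2.2)⁻¹

end NestedInstantons

/-!
The torus-fixed points are classified by diagonalizing a single generic torus element.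

Let `X` represent a fixed point. For every torus element `t` some gauge transformation `g` satisfies
`g • t • X = X`. On `V_0`, the vector `I w_a` is then an eigenvector of `g` of eigenvalue `e_a`,
while `B₁` and `B₂` divide eigenvalues by `t₁` and `t₂`. By stability `V_0` is spanned by vectors of
weights `e_a t₁^{-k} t₂^{-l}`, whereas `J` pairs only with the weights `e_c t₁ t₂`; hence `J = 0`
for a generic `t` (`J_eq_zero_of_fixed`). Therefore `B₁` and `B₂` commute on `V_0`, and `V_0` is
spanned by the monomials `B₁^k B₂^l I w_a`. These are eigenvectors of `g` with pairwise distinct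
eigenvalues, so the nonzero ones form a basis, and their boxes form the coloured partition `μ_0`.

The maps `F` embed `V_i` into `V_0` as a subspace invariant under `B₁`, `B₂` and `g`. As `g` has
simple spectrum, this subspace is spanned by the monomials it contains
(`le_span_eigenvectors_of_invariant`), and their boxes form an upward closed subset of `μ_0`,
that is, a skew diagram `μ_0 ∖ μ_i`. Finally `G = 0` because `F G = 0` and `F` is injective. This
gives a monomial basis (`exists_isMonomialBasis_of_fixed`). One generic element is enough, namely
`(2, 3, (5^a)_a)`.

Conversely, a monomial basis yields the homomorphism `lam` acting diagonally with the prescribed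
weights, and hence shows that the point is fixed (`IsMonomialBasis.lam_smul_smul`). The partition
is recovered from `X` (`IsMonomialBasis.partition_unique`), determines the gauge orbit
(`IsMonomialBasis.exists_smul_eq`), and may be arbitrary (`exists_isMonomialBasis_of_partition`).
-/

namespace NestedInstantons

variable {N r : ℕ} {n : Fin (N + 1) → ℕ}

/-! ### Boxes of coloured partitions -/

/-- The boxes `(a, k, l)` of a coloured partition. -/
def colouredBoxes (μ : Fin r → YoungDiagram) : Finset (Fin r × ℕ × ℕ) :=
  (Finset.univ.sigma fun a => (μ a).cells).map (Equiv.sigmaEquivProd _ _).toEmbedding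

theorem mem_colouredBoxes {μ : Fin r → YoungDiagram} {b : Fin r × ℕ × ℕ} :
    b ∈ colouredBoxes μ ↔ b.2 ∈ μ b.1 := by
  simp [colouredBoxes]

theorem card_colouredBoxes (μ : Fin r → YoungDiagram) :
    (colouredBoxes μ).card = colouredSize μ := by
  simp [colouredBoxes, colouredSize, YoungDiagram.card]

/-- The coloured partition with a given set of boxes, which has to be finite and, in each colour,
closed under decreasing coordinates. -/
noncomputable def colouredPartitionOf (P : Set (Fin r × ℕ × ℕ)) (hfin : P.Finite)
    (hlow : ∀ a k l k' l', k ≤ k' → l ≤ l' → (a, k', l') ∈ P → (a, k, l) ∈ P) (a : Fin r) :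
    YoungDiagram where
  cells := (hfin.preimage (Prod.mk_right_injective a).injOn).toFinset
  isLowerSet := by
    rintro ⟨k', l'⟩ ⟨k, l⟩ hle h
    simp only [Set.Finite.coe_toFinset, Set.mem_preimage] at h ⊢
    exact hlow a k l k' l' hle.1 hle.2 h

theorem mem_colouredPartitionOf {P : Set (Fin r × ℕ × ℕ)} {hfin : P.Finite}
    {hlow : ∀ a k l k' l', k ≤ k' → l ≤ l' → (a, k', l') ∈ P → (a, k, l) ∈ P} {a : Fin r}
    {c : ℕ × ℕ} : c ∈ colouredPartitionOf P hfin hlow a ↔ (a, c) ∈ P := by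
  rw [← YoungDiagram.mem_cells]
  simp [colouredPartitionOf]

theorem colouredSize_colouredPartitionOf {P : Set (Fin r × ℕ × ℕ)} {hfin : P.Finite}
    {hlow : ∀ a k l k' l', k ≤ k' → l ≤ l' → (a, k', l') ∈ P → (a, k, l) ∈ P} :
    colouredSize (colouredPartitionOf P hfin hlow) = P.ncard := by
  rw [← card_colouredBoxes, ← Set.ncard_coe_finset]
  congr 1
  ext b
  simp [mem_colouredBoxes, mem_colouredPartitionOf]

namespace NestedPartition

variable {μ ν : NestedPartition r n} {i : Fin (N + 1)}

theorem mem_boxes_zero {b : Fin r × ℕ × ℕ} : b ∈ μ.boxes 0 ↔ b.2 ∈ μ.part 0 b.1 := by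
  simp [boxes]

theorem boxes_subset_boxes_zero (i : Fin (N + 1)) : μ.boxes i ⊆ μ.boxes 0 :=
  fun _ hb => mem_boxes_zero.2 hb.1

theorem boxes_succ_subset (i : Fin N) : μ.boxes i.succ ⊆ μ.boxes i.castSucc :=
  fun b hb => ⟨hb.1, fun h hb' => hb.2 i.succ_pos
    (μ.nested _ _ h i.castSucc_lt_succ.le b.1 hb')⟩

/-- The skew diagram `μ_0 ∖ μ_i` is upward closed in `μ_0`: it contains every box of `μ_0` which is
of the same colour as, and dominates coordinatewise, one of its boxes. -/
theorem mem_boxes_of_le {b c : Fin r × ℕ × ℕ} (hb : b ∈ μ.boxes i) (h1 : b.1 = c.1)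
    (h2 : b.2 ≤ c.2) (hc : c ∈ μ.boxes 0) : c ∈ μ.boxes i :=
  ⟨mem_boxes_zero.1 hc, fun hi h => hb.2 hi (by rw [h1]; exact (μ.part i c.1).isLowerSet h2 h)⟩

theorem mem_boxes_zero_of_le {b c : Fin r × ℕ × ℕ} (hc : c ∈ μ.boxes 0) (h1 : b.1 = c.1)
    (h2 : b.2 ≤ c.2) : b ∈ μ.boxes 0 :=
  mem_boxes_zero.2 (by rw [h1]; exact (μ.part 0 c.1).isLowerSet h2 (mem_boxes_zero.1 hc))

theorem mem_part_iff_of_pos (hi : 0 < i) {b : Fin r × ℕ × ℕ} :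
    b.2 ∈ μ.part i b.1 ↔ b ∈ μ.boxes 0 ∧ b ∉ μ.boxes i := by
  constructor
  · exact fun h => ⟨mem_boxes_zero.2 (μ.nested_zero i b.1 h), fun h' => h'.2 hi h⟩
  · rintro ⟨h0, h⟩
    by_contra h'
    exact h ⟨mem_boxes_zero.1 h0, fun _ => h'⟩

/-- A nested coloured partition is determined by the box sets `μ_0` and `μ_0 ∖ μ_i`, since all
`μ_i` are contained in `μ_0`. -/
theorem ext_boxes (h : ∀ i, μ.boxes i = ν.boxes i) : μ = ν := by
  refine NestedPartition.ext ?_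
  funext i a
  refine SetLike.ext fun c => ?_
  rcases Fin.eq_zero_or_eq_succ i with rfl | ⟨j, rfl⟩
  · rw [← mem_boxes_zero (b := (a, c)), h, mem_boxes_zero]
  · rw [mem_part_iff_of_pos j.succ_pos (b := (a, c)), h, h,
      mem_part_iff_of_pos j.succ_pos (b := (a, c))]

theorem boxes_zero_eq : μ.boxes 0 = colouredBoxes (μ.part 0) := by
  ext b
  simp [mem_boxes_zero, mem_colouredBoxes]

theorem boxes_eq_of_pos (hi : 0 < i) :
    μ.boxes i = (colouredBoxes (μ.part 0) \ colouredBoxes (μ.part i) : Finset _) := by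
  ext b
  simp [boxes, mem_colouredBoxes, hi]

theorem finite_boxes (μ : NestedPartition r n) (i : Fin (N + 1)) : (μ.boxes i).Finite :=
  (Finset.finite_toSet (colouredBoxes (μ.part 0))).subset
    (boxes_zero_eq (μ := μ) ▸ boxes_subset_boxes_zero i)

instance (μ : NestedPartition r n) (i : Fin (N + 1)) : Finite (μ.boxes i) := μ.finite_boxes i

/-- The size conditions say that the bases indexed by boxes have the right cardinality `n_i`. -/
theorem card_boxes (μ : NestedPartition r n) (i : Fin (N + 1)) : Nat.card (μ.boxes i) = n i := by
  rw [Nat.card_coe_set_eq]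
  rcases Fin.eq_zero_or_eq_succ i with rfl | ⟨j, rfl⟩
  · rw [boxes_zero_eq, Set.ncard_coe_finset, card_colouredBoxes, μ.size_zero]
  · have hsub : colouredBoxes (μ.part j.succ) ⊆ colouredBoxes (μ.part 0) := fun b hb =>
      mem_colouredBoxes.2 (μ.nested_zero _ b.1 (mem_colouredBoxes.1 hb))
    have h := μ.size _ j.succ_pos
    rw [boxes_eq_of_pos j.succ_pos, Set.ncard_coe_finset, Finset.card_sdiff_of_subset hsub,
      card_colouredBoxes, card_colouredBoxes, μ.size_zero]
    omega

/-- Nested coloured partitions may be prescribed by their box sets: a finite lower set `D 0` and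
a decreasing chain of subsets `D i` which are upward closed in `D 0`. -/
theorem exists_boxes_eq {D : Fin (N + 1) → Set (Fin r × ℕ × ℕ)} (hanti : Antitone D)
    (hfin : ∀ i, (D i).Finite)
    (hlow : ∀ a k l k' l', k ≤ k' → l ≤ l' → (a, k', l') ∈ D 0 → (a, k, l) ∈ D 0)
    (hup : ∀ i a k l k' l', k ≤ k' → l ≤ l' → (a, k, l) ∈ D i → (a, k', l') ∈ D 0 →
      (a, k', l') ∈ D i)
    (hcard : ∀ i, (D i).ncard = n i) : ∃ μ : NestedPartition r n, ∀ i, μ.boxes i = D i := by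
  have hlow' : ∀ i, ∀ a k l k' l', k ≤ k' → l ≤ l' →
      (a, k', l') ∈ D 0 \ {b | 0 < i ∧ b ∈ D i} → (a, k, l) ∈ D 0 \ {b | 0 < i ∧ b ∈ D i} :=
    fun i a k l k' l' hk hl hb => ⟨hlow a k l k' l' hk hl hb.1,
      fun h => hb.2 ⟨h.1, hup i a k l k' l' hk hl h.2 hb.1⟩⟩
  have hfin' : ∀ i : Fin (N + 1), (D 0 \ {b | 0 < i ∧ b ∈ D i}).Finite :=
    fun i => (hfin 0).subset Set.sdiff_subset
  refine ⟨
    { part := fun i => colouredPartitionOf _ (hfin' i) (hlow' i)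
      nested := ?_
      nested_zero := ?_
      size_zero := ?_
      size := ?_ }, ?_⟩
  · intro i j hi hij a c hc
    rw [mem_colouredPartitionOf] at hc ⊢
    exact ⟨hc.1, fun h => hc.2 ⟨hi, hanti hij h.2⟩⟩
  · intro i a c hc
    rw [mem_colouredPartitionOf] at hc ⊢
    exact ⟨hc.1, fun h => absurd h.1 (lt_irrefl _)⟩
  · rw [colouredSize_colouredPartitionOf, ← hcard 0]
    simp
  · intro i hi
    rw [colouredSize_colouredPartitionOf, ← hcard 0, ← hcard i]
    simp only [hi, true_and, Set.ofPred_mem_eq]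
    rw [Set.ncard_sdiff (hanti (Fin.zero_le i)) (hfin i),
      Nat.cast_sub (Set.ncard_le_ncard (hanti (Fin.zero_le i)) (hfin 0))]
  · intro i
    ext ⟨a, c⟩
    simp only [boxes, Set.mem_ofPred_eq, mem_colouredPartitionOf]
    rcases Fin.eq_zero_or_eq_succ i with rfl | ⟨j, rfl⟩
    · simp
    · have h := @hanti 0 j.succ (Fin.zero_le _) (a, c)
      simp only [Set.mem_sdiff, Set.mem_ofPred_eq, lt_irrefl, false_and, not_false_eq_true,
        and_true, Fin.succ_pos, true_and, true_implies, not_and, not_not]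
      exact ⟨fun h' => h'.2 h'.1, fun h' => ⟨h h', fun _ => h'⟩⟩

end NestedPartition

/-! ### Gauge transformations intertwining two data -/

/-- To identify `g • X` it suffices to compare the maps without inverting `g`. -/
theorem gauge_smul_eq_of_intertwines {X Y : Datum r n} (g : Gauge n)
    (hB₁ : ∀ i x, g i (X.B₁ i x) = Y.B₁ i (g i x)) (hB₂ : ∀ i x, g i (X.B₂ i x) = Y.B₂ i (g i x))
    (hI : ∀ w, g 0 (X.I w) = Y.I w) (hJ : ∀ x, X.J x = Y.J (g 0 x))
    (hF : ∀ i x, g i.castSucc (X.F i x) = Y.F i (g i.succ x))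
    (hG : ∀ i x, g i.succ (X.G i x) = Y.G i (g i.castSucc x)) : g • X = Y := by
  rw [gauge_smul_def]
  apply Datum.ext
  · funext i; apply LinearMap.ext; intro x; simp [gaugeAct, hB₁]
  · funext i; apply LinearMap.ext; intro x; simp [gaugeAct, hB₂]
  · apply LinearMap.ext; intro x; simp [gaugeAct, hI]
  · apply LinearMap.ext; intro x; simp [gaugeAct, hJ]
  · funext i; apply LinearMap.ext; intro x; simp [gaugeAct, hF]
  · funext i; apply LinearMap.ext; intro x; simp [gaugeAct, hG]

section Intertwine

variable {X Y : Datum r n} {g : Gauge n}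

theorem map_B₁_of_smul_eq (h : g • X = Y) (i x) : g i (X.B₁ i x) = Y.B₁ i (g i x) := by
  subst h; simp [gauge_smul_def, gaugeAct]

theorem map_B₂_of_smul_eq (h : g • X = Y) (i x) : g i (X.B₂ i x) = Y.B₂ i (g i x) := by
  subst h; simp [gauge_smul_def, gaugeAct]

theorem map_I_of_smul_eq (h : g • X = Y) (w) : g 0 (X.I w) = Y.I w := by
  subst h; simp [gauge_smul_def, gaugeAct]

theorem map_J_of_smul_eq (h : g • X = Y) (x) : X.J x = Y.J (g 0 x) := by
  subst h; simp [gauge_smul_def, gaugeAct]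

theorem map_F_of_smul_eq (h : g • X = Y) (i x) :
    g i.castSucc (X.F i x) = Y.F i (g i.succ x) := by
  subst h; simp [gauge_smul_def, gaugeAct]

end Intertwine

/-! ### Monomials and the embeddings into `V_0` -/

namespace Datum

/-- The vector `B₁^k B₂^l I w_a` of `V_0` attached to the box `(a, k, l)`. -/
def monomial (X : Datum r n) (b : Fin r × ℕ × ℕ) : V n 0 :=
  ((X.B₁ 0) ^ b.2.1) (((X.B₂ 0) ^ b.2.2) (X.I (Pi.single b.1 1)))

/-- The composite `F^1 ∘ ⋯ ∘ F^i : V_i → V_0`. -/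
noncomputable def toZero (X : Datum r n) (i : Fin (N + 1)) : V n i →ₗ[ℂ] V n 0 :=
  Fin.induction (motive := fun i => V n i →ₗ[ℂ] V n 0) LinearMap.id (fun i f => f ∘ₗ X.F i) i

variable {X : Datum r n}

@[simp]
theorem toZero_zero : X.toZero 0 = LinearMap.id := rfl

theorem toZero_succ (i : Fin N) : X.toZero i.succ = X.toZero i.castSucc ∘ₗ X.F i := rfl

theorem IsStable.toZero_injective (h : X.IsStable) (i : Fin (N + 1)) :
    Function.Injective (X.toZero i) := by
  induction i using Fin.induction with
  | zero => exact Function.injective_id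
  | succ i ih => exact ih.comp (h.injective i)

theorem SatisfiesRelations.toZero_B₁ (h : X.SatisfiesRelations) (i : Fin (N + 1)) (x : V n i) :
    X.toZero i (X.B₁ i x) = X.B₁ 0 (X.toZero i x) := by
  induction i using Fin.induction with
  | zero => rfl
  | succ i ih =>
    have e := LinearMap.congr_fun (sub_eq_zero.1 (h.BF₁ i)) x
    simp only [LinearMap.comp_apply] at e
    simp only [toZero_succ, LinearMap.comp_apply, ← ih, e]

theorem SatisfiesRelations.toZero_B₂ (h : X.SatisfiesRelations) (i : Fin (N + 1)) (x : V n i) :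
    X.toZero i (X.B₂ i x) = X.B₂ 0 (X.toZero i x) := by
  induction i using Fin.induction with
  | zero => rfl
  | succ i ih =>
    have e := LinearMap.congr_fun (sub_eq_zero.1 (h.BF₂ i)) x
    simp only [LinearMap.comp_apply] at e
    simp only [toZero_succ, LinearMap.comp_apply, ← ih, e]

end Datum

/-! ### Consequences of having a monomial basis -/

namespace IsMonomialBasis

variable {X Y : Datum r n} {μ ν : NestedPartition r n}
  {v v' : ∀ i : Fin (N + 1), Fin r × ℕ × ℕ → V n i}

theorem linearMap_ext (h : IsMonomialBasis X μ v) {i : Fin (N + 1)} {M : Type*} [AddCommGroup M]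
    [Module ℂ M] {f g : V n i →ₗ[ℂ] M} (hfg : ∀ b ∈ μ.boxes i, f (v i b) = g (v i b)) : f = g := by
  refine LinearMap.ext_on (h.span i) ?_
  rintro _ ⟨b, hb, rfl⟩
  exact hfg b hb

/-- Above a box of `μ_0 ∖ μ_i`, leaving `μ_0 ∖ μ_i` means leaving `μ_0`; this is why the relations
hold also at the boundary of the skew diagram, where both sides vanish. -/
theorem notMem_boxes_zero_of_le {i : Fin (N + 1)} {b c : Fin r × ℕ × ℕ}
    (hb : b ∈ μ.boxes i) (h1 : b.1 = c.1) (h2 : b.2 ≤ c.2) (hc : c ∉ μ.boxes i) :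
    c ∉ μ.boxes 0 :=
  fun h0 => hc (NestedPartition.mem_boxes_of_le hb h1 h2 h0)

theorem B₁_apply_of_le (h : IsMonomialBasis X μ v) {i : Fin (N + 1)} {a : Fin r} {k l k' l' : ℕ}
    (hb : (a, k', l') ∈ μ.boxes i) (hk : k' ≤ k) (hl : l' ≤ l) :
    X.B₁ i (v i (a, k, l)) = v i (a, k + 1, l) := by
  by_cases hc : (a, k, l) ∈ μ.boxes i
  · exact h.B₁ i a k l hc
  · have h0 : (a, k, l) ∉ μ.boxes 0 := notMem_boxes_zero_of_le hb rfl ⟨hk, hl⟩ hc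
    have h1 : (a, k + 1, l) ∉ μ.boxes i := fun h' => h0 <|
      NestedPartition.mem_boxes_zero_of_le (NestedPartition.boxes_subset_boxes_zero i h') rfl
        ⟨k.le_succ, le_rfl⟩
    rw [h.off i _ hc, h.off i _ h1, map_zero]

theorem B₂_apply_of_le (h : IsMonomialBasis X μ v) {i : Fin (N + 1)} {a : Fin r} {k l k' l' : ℕ}
    (hb : (a, k', l') ∈ μ.boxes i) (hk : k' ≤ k) (hl : l' ≤ l) :
    X.B₂ i (v i (a, k, l)) = v i (a, k, l + 1) := by
  by_cases hc : (a, k, l) ∈ μ.boxes i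
  · exact h.B₂ i a k l hc
  · have h0 : (a, k, l) ∉ μ.boxes 0 := notMem_boxes_zero_of_le hb rfl ⟨hk, hl⟩ hc
    have h1 : (a, k, l + 1) ∉ μ.boxes i := fun h' => h0 <|
      NestedPartition.mem_boxes_zero_of_le (NestedPartition.boxes_subset_boxes_zero i h') rfl
        ⟨le_rfl, l.le_succ⟩
    rw [h.off i _ hc, h.off i _ h1, map_zero]

theorem F_apply_of_le (h : IsMonomialBasis X μ v) {i : Fin N} {b c : Fin r × ℕ × ℕ}
    (hb : b ∈ μ.boxes i.succ) (h1 : b.1 = c.1) (h2 : b.2 ≤ c.2) :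
    X.F i (v i.succ c) = v i.castSucc c := by
  by_cases hc : c ∈ μ.boxes i.succ
  · exact h.F i c hc
  · have h0 : c ∉ μ.boxes 0 := notMem_boxes_zero_of_le hb h1 h2 hc
    rw [h.off _ _ hc, h.off _ _ fun h' => h0 (NestedPartition.boxes_subset_boxes_zero _ h'),
      map_zero]

theorem B₁_zero_apply (h : IsMonomialBasis X μ v) (a : Fin r) (k l : ℕ) :
    X.B₁ 0 (v 0 (a, k, l)) = v 0 (a, k + 1, l) := by
  by_cases hc : (a, k, l) ∈ μ.boxes 0
  · exact h.B₁ 0 a k l hc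
  · rw [h.off 0 _ hc, h.off 0 (a, k + 1, l) fun h' => hc
      (NestedPartition.mem_boxes_zero_of_le h' rfl ⟨k.le_succ, le_rfl⟩), map_zero]

theorem B₂_zero_apply (h : IsMonomialBasis X μ v) (a : Fin r) (k l : ℕ) :
    X.B₂ 0 (v 0 (a, k, l)) = v 0 (a, k, l + 1) := by
  by_cases hc : (a, k, l) ∈ μ.boxes 0
  · exact h.B₂ 0 a k l hc
  · rw [h.off 0 _ hc, h.off 0 (a, k, l + 1) fun h' => hc
      (NestedPartition.mem_boxes_zero_of_le h' rfl ⟨le_rfl, l.le_succ⟩), map_zero]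

/-- The basis of `V_0` is forced: its vectors are the nonzero monomials `B₁^k B₂^l I w_a`. -/
theorem apply_zero_eq_monomial (h : IsMonomialBasis X μ v) (b : Fin r × ℕ × ℕ) :
    v 0 b = X.monomial b := by
  obtain ⟨a, k, l⟩ := b
  have h2 : ∀ l, ((X.B₂ 0) ^ l) (X.I (Pi.single a 1)) = v 0 (a, 0, l) := by
    intro l
    induction l with
    | zero => simpa using h.I a
    | succ l ih => rw [pow_succ', Module.End.mul_apply, ih, h.B₂_zero_apply]
  simp only [Datum.monomial, h2]
  induction k with
  | zero => simp
  | succ k ih => rw [pow_succ', Module.End.mul_apply, ← ih, h.B₁_zero_apply]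

theorem apply_ne_zero (h : IsMonomialBasis X μ v) {i : Fin (N + 1)} {b : Fin r × ℕ × ℕ}
    (hb : b ∈ μ.boxes i) : v i b ≠ 0 :=
  (h.linearIndependent i).ne_zero (⟨b, hb⟩ : μ.boxes i)

theorem comm (h : IsMonomialBasis X μ v) (i : Fin (N + 1)) :
    X.B₁ i ∘ₗ X.B₂ i - X.B₂ i ∘ₗ X.B₁ i = 0 := by
  rw [sub_eq_zero]
  refine h.linearMap_ext ?_
  rintro ⟨a, k, l⟩ hb
  rw [LinearMap.comp_apply, LinearMap.comp_apply, h.B₁ i a k l hb, h.B₂ i a k l hb,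
    h.B₁_apply_of_le hb le_rfl l.le_succ, h.B₂_apply_of_le hb k.le_succ le_rfl]

theorem satisfiesRelations (h : IsMonomialBasis X μ v) : X.SatisfiesRelations where
  adhm := by rw [h.comm 0, h.J, LinearMap.comp_zero, add_zero]
  comm i _ := h.comm i
  BF₁ i := by
    rw [sub_eq_zero]
    refine h.linearMap_ext ?_
    rintro ⟨a, k, l⟩ hb
    rw [LinearMap.comp_apply, LinearMap.comp_apply, h.B₁ _ a k l hb, h.F i _ hb,
      h.B₁ _ a k l (NestedPartition.boxes_succ_subset i hb),
      h.F_apply_of_le (c := (a, k + 1, l)) hb rfl ⟨k.le_succ, le_rfl⟩]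
  BF₂ i := by
    rw [sub_eq_zero]
    refine h.linearMap_ext ?_
    rintro ⟨a, k, l⟩ hb
    rw [LinearMap.comp_apply, LinearMap.comp_apply, h.B₂ _ a k l hb, h.F i _ hb,
      h.B₂ _ a k l (NestedPartition.boxes_succ_subset i hb),
      h.F_apply_of_le (c := (a, k, l + 1)) hb rfl ⟨le_rfl, l.le_succ⟩]
  GB₁ i := by simp [h.G i]
  GB₂ i := by simp [h.G i]
  FG i := by simp [h.G i]
  JF _ := by rw [h.J]; exact LinearMap.zero_comp _
  GI _ := by rw [h.G]; exact LinearMap.zero_comp _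

theorem isStable (h : IsMonomialBasis X μ v) : X.IsStable where
  injective i := by
    refine LinearMap.injective_of_linearIndependent (v := fun b : μ.boxes i.succ => v i.succ b)
      ?_ ?_
    · rw [← h.span i.succ, Set.image_eq_range]
    · have e : (X.F i ∘ fun b : μ.boxes i.succ => v i.succ b) =
          (fun b : μ.boxes i.castSucc => v i.castSucc b) ∘
            Set.inclusion (NestedPartition.boxes_succ_subset i) :=
        funext fun b => h.F i b b.2
      rw [e]
      exact (h.linearIndependent i.castSucc).comp _ (Set.inclusion_injective _)
  adhm_stable S hI h1 h2 := by
    rw [eq_top_iff, ← h.span 0, Submodule.span_le]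
    rintro _ ⟨⟨a, k, l⟩, -, rfl⟩
    have hl : ∀ l, v 0 (a, 0, l) ∈ S := by
      intro l
      induction l with
      | zero => exact hI ⟨_, h.I a⟩
      | succ l ih => exact h2 ⟨_, ih, h.B₂_zero_apply a 0 l⟩
    change v 0 (a, k, l) ∈ S
    induction k with
    | zero => exact hl l
    | succ k ih => exact h1 ⟨_, ih, h.B₁_zero_apply a k l⟩

/-- The basis of `V_i` indexed by the boxes of `μ_0 ∖ μ_i` (of `μ_0` for `i = 0`). -/
noncomputable def basis (h : IsMonomialBasis X μ v) (i : Fin (N + 1)) :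
    Module.Basis (μ.boxes i) ℂ (V n i) :=
  Module.Basis.mk (h.linearIndependent i) (by rw [← Set.image_eq_range, h.span i])

theorem basis_apply (h : IsMonomialBasis X μ v) (i : Fin (N + 1)) (b : μ.boxes i) :
    h.basis i b = v i b := by
  simp [basis]

/-! ### The homomorphism from the torus to the gauge group -/

/-- The torus acts on `V_i` diagonally in the monomial basis, with weights `boxWeight`. -/
noncomputable def lam (h : IsMonomialBasis X μ v) : Torus r →* Gauge n where
  toFun t i := (h.basis i).equiv
    ((h.basis i).unitsSMul fun b => boxWeight t b) (Equiv.refl _)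
  map_one' := by
    funext i
    refine LinearEquiv.toLinearMap_injective ((h.basis i).ext fun b => ?_)
    simp [Module.Basis.unitsSMul_apply, boxWeight]
  map_mul' s t := by
    funext i
    refine LinearEquiv.toLinearMap_injective ((h.basis i).ext fun b => ?_)
    have e : boxWeight (s * t) b = boxWeight t b * boxWeight s b := by
      simp only [boxWeight, Prod.fst_mul, Prod.snd_mul, Pi.mul_apply, mul_pow, mul_inv]
      ac_rfl
    simp [Module.Basis.unitsSMul_apply, e, mul_smul, Units.smul_def]

theorem lam_apply (h : IsMonomialBasis X μ v) (t : Torus r) (i : Fin (N + 1))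
    (b : Fin r × ℕ × ℕ) : h.lam t i (v i b) = boxWeight t b • v i b := by
  by_cases hb : b ∈ μ.boxes i
  · have e := Module.Basis.equiv_apply (h.basis i) ⟨b, hb⟩
      ((h.basis i).unitsSMul fun b => boxWeight t b) (Equiv.refl _)
    rw [Module.Basis.unitsSMul_apply, Equiv.refl_apply, h.basis_apply] at e
    exact e
  · rw [h.off i b hb, map_zero, smul_zero]

/-- The torus acts on `X` through the inverse of `lam`; in particular the point of the moduli space
represented by `X` is fixed. -/
theorem lam_smul_smul (h : IsMonomialBasis X μ v) (t : Torus r) : h.lam t • t • X = X := by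
  have hw₁ : ∀ a k l, t.1 * boxWeight t (a, k + 1, l) = boxWeight t (a, k, l) := by
    intro a k l
    simp only [boxWeight, pow_succ, mul_inv]
    rw [show t.1 * (t.2.2 a * ((t.1 ^ k)⁻¹ * t.1⁻¹) * (t.2.1 ^ l)⁻¹) =
      t.1 * t.1⁻¹ * (t.2.2 a * (t.1 ^ k)⁻¹ * (t.2.1 ^ l)⁻¹) by ac_rfl, mul_inv_cancel, one_mul]
  have hw₂ : ∀ a k l, t.2.1 * boxWeight t (a, k, l + 1) = boxWeight t (a, k, l) := by
    intro a k l
    simp only [boxWeight, pow_succ, mul_inv]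
    rw [show t.2.1 * (t.2.2 a * (t.1 ^ k)⁻¹ * ((t.2.1 ^ l)⁻¹ * t.2.1⁻¹)) =
      t.2.1 * t.2.1⁻¹ * (t.2.2 a * (t.1 ^ k)⁻¹ * (t.2.1 ^ l)⁻¹) by ac_rfl, mul_inv_cancel,
      one_mul]
  apply gauge_smul_eq_of_intertwines
  · intro i
    refine LinearMap.congr_fun (f := (h.lam t i).toLinearMap ∘ₗ (t • X).B₁ i)
      (g := X.B₁ i ∘ₗ (h.lam t i).toLinearMap) (h.linearMap_ext ?_)
    rintro ⟨a, k, l⟩ hb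
    simp only [torus_smul_def, torusAct, LinearMap.comp_apply, LinearMap.smul_apply,
      LinearEquiv.coe_coe, h.B₁ i a k l hb, map_smul, h.lam_apply, Units.smul_def, ← hw₁ a k l,
      mul_smul]
  · intro i
    refine LinearMap.congr_fun (f := (h.lam t i).toLinearMap ∘ₗ (t • X).B₂ i)
      (g := X.B₂ i ∘ₗ (h.lam t i).toLinearMap) (h.linearMap_ext ?_)
    rintro ⟨a, k, l⟩ hb
    simp only [torus_smul_def, torusAct, LinearMap.comp_apply, LinearMap.smul_apply,
      LinearEquiv.coe_coe, h.B₂ i a k l hb, map_smul, h.lam_apply, Units.smul_def, ← hw₂ a k l,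
      mul_smul]
  · refine LinearMap.congr_fun (f := (h.lam t 0).toLinearMap ∘ₗ (t • X).I) (g := X.I)
      ((Pi.basisFun ℂ (Fin r)).ext fun a => ?_)
    have e : diagW t.2.2⁻¹ (Pi.single a 1) = (t.2.2 a)⁻¹ • Pi.single a (1 : ℂ) := by
      funext c
      by_cases hc : c = a
      · subst hc; simp [diagW, Units.smul_def]
      · simp [diagW, hc]
    simp [torus_smul_def, torusAct, e, h.I, h.lam_apply, boxWeight, smul_smul, Units.smul_def]
  · intro x
    simp [torus_smul_def, torusAct, h.J]
  · intro i
    refine LinearMap.congr_fun (f := (h.lam t i.castSucc).toLinearMap ∘ₗ (t • X).F i)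
      (g := X.F i ∘ₗ (h.lam t i.succ).toLinearMap) (h.linearMap_ext ?_)
    intro b hb
    simp only [torus_smul_def, torusAct, LinearMap.comp_apply, LinearEquiv.coe_coe, h.F i b hb,
      h.lam_apply, Units.smul_def, map_smul]
  · intro i x
    simp [torus_smul_def, torusAct, h.G i]

/-! ### The partition determines the gauge orbit and conversely -/

/-- Monomial bases are transported along the gauge group, so the partition depends on the gauge
orbit only. -/
theorem smul (h : IsMonomialBasis X μ v) (g : Gauge n) :
    IsMonomialBasis (g • X) μ fun i b => g i (v i b) where
  linearIndependent i := (h.linearIndependent i).map' (g i).toLinearMap (g i).ker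
  span i := by
    have e : (fun b => g i (v i b)) '' μ.boxes i = (g i).toLinearMap '' (v i '' μ.boxes i) := by
      rw [Set.image_image]; rfl
    rw [e, Submodule.span_image, h.span i, Submodule.map_top, LinearEquiv.range]
  off i b hb := by rw [h.off i b hb, map_zero]
  B₁ i a k l hb := by rw [← map_B₁_of_smul_eq rfl, h.B₁ i a k l hb]
  B₂ i a k l hb := by rw [← map_B₂_of_smul_eq rfl, h.B₂ i a k l hb]
  I a := by rw [← map_I_of_smul_eq rfl, h.I]
  J := by simp [gauge_smul_def, gaugeAct, h.J]
  F i b hb := by rw [← map_F_of_smul_eq rfl, h.F i b hb]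
  G i := by simp [gauge_smul_def, gaugeAct, h.G]

/-- Two data with monomial bases of the same shape are related by the change of basis. -/
theorem exists_smul_eq (h : IsMonomialBasis X μ v) (h' : IsMonomialBasis Y μ v') :
    ∃ g : Gauge n, g • X = Y := by
  let g : Gauge n := fun i => (h.basis i).equiv (h'.basis i) (Equiv.refl _)
  have hg : ∀ i b, g i (v i b) = v' i b := by
    intro i b
    by_cases hb : b ∈ μ.boxes i
    · have e := Module.Basis.equiv_apply (h.basis i) ⟨b, hb⟩ (h'.basis i) (Equiv.refl _)
      rw [h.basis_apply, h'.basis_apply] at e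
      exact e
    · rw [h.off i b hb, h'.off i b hb, map_zero]
  refine ⟨g, gauge_smul_eq_of_intertwines g ?_ ?_ ?_ ?_ ?_ ?_⟩
  · intro i
    refine LinearMap.congr_fun (f := (g i).toLinearMap ∘ₗ X.B₁ i)
      (g := Y.B₁ i ∘ₗ (g i).toLinearMap) (h.linearMap_ext ?_)
    rintro ⟨a, k, l⟩ hb
    simp [h.B₁ i a k l hb, h'.B₁ i a k l hb, hg]
  · intro i
    refine LinearMap.congr_fun (f := (g i).toLinearMap ∘ₗ X.B₂ i)
      (g := Y.B₂ i ∘ₗ (g i).toLinearMap) (h.linearMap_ext ?_)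
    rintro ⟨a, k, l⟩ hb
    simp [h.B₂ i a k l hb, h'.B₂ i a k l hb, hg]
  · refine LinearMap.congr_fun (f := (g 0).toLinearMap ∘ₗ X.I) (g := Y.I)
      ((Pi.basisFun ℂ (Fin r)).ext fun a => ?_)
    simp [h.I, h'.I, hg]
  · simp [h.J, h'.J]
  · intro i
    refine LinearMap.congr_fun (f := (g i.castSucc).toLinearMap ∘ₗ X.F i)
      (g := Y.F i ∘ₗ (g i.succ).toLinearMap) (h.linearMap_ext ?_)
    intro b hb
    simp [h.F i b hb, h'.F i b hb, hg]
  · simp [h.G, h'.G]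

theorem toZero_apply (h : IsMonomialBasis X μ v) {i : Fin (N + 1)} {b : Fin r × ℕ × ℕ}
    (hb : b ∈ μ.boxes i) : X.toZero i (v i b) = v 0 b := by
  induction i using Fin.induction with
  | zero => rfl
  | succ i ih =>
    rw [Datum.toZero_succ, LinearMap.comp_apply, h.F i b hb,
      ih (NestedPartition.boxes_succ_subset i hb)]

/-- The boxes of `μ_0 ∖ μ_i` are those whose monomial vector is nonzero and lies in the image
of `V_i`; hence `μ` depends on `X` only. -/
theorem mem_boxes_iff (h : IsMonomialBasis X μ v) {i : Fin (N + 1)} {b : Fin r × ℕ × ℕ} :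
    b ∈ μ.boxes i ↔ X.monomial b ≠ 0 ∧ X.monomial b ∈ LinearMap.range (X.toZero i) := by
  rw [← h.apply_zero_eq_monomial]
  constructor
  · intro hb
    exact ⟨h.apply_ne_zero (NestedPartition.boxes_subset_boxes_zero i hb), v i b,
      h.toZero_apply hb⟩
  · rintro ⟨h0, hr⟩
    have hb0 : b ∈ μ.boxes 0 := by
      by_contra hb
      exact h0 (h.off 0 b hb)
    -- by linear independence, the image of `V_i` contains only those basis vectors of `V_0`
    -- which are images of basis vectors of `V_i`
    let T : Set (μ.boxes 0) := {c | (c : Fin r × ℕ × ℕ) ∈ μ.boxes i}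
    have e : LinearMap.range (X.toZero i) =
        Submodule.span ℂ ((fun c : μ.boxes 0 => v 0 c) '' T) := by
      rw [LinearMap.range_eq_map, ← h.span i, Submodule.map_span, Set.image_image]
      congr 1
      ext x
      constructor
      · rintro ⟨c, hc, rfl⟩
        exact ⟨⟨c, NestedPartition.boxes_subset_boxes_zero i hc⟩, hc, (h.toZero_apply hc).symm⟩
      · rintro ⟨c, hc, rfl⟩
        exact ⟨c, hc, h.toZero_apply hc⟩
    by_contra hb
    rw [e] at hr
    exact (h.linearIndependent 0).notMem_span_image (s := T) (x := ⟨b, hb0⟩) hb hr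

theorem partition_unique (h : IsMonomialBasis X μ v) (h' : IsMonomialBasis X ν v') : μ = ν :=
  NestedPartition.ext_boxes fun i => Set.ext fun _ => by rw [h.mem_boxes_iff, h'.mem_boxes_iff]

end IsMonomialBasis

/-! ### The monomial representation attached to a nested coloured partition -/

open Classical in
/-- Every nested coloured partition occurs: choose any bases indexed by the boxes and define the
maps by the shifts of boxes. -/
theorem exists_isMonomialBasis_of_partition (μ : NestedPartition r n) :
    ∃ (X : Datum r n) (v : ∀ i : Fin (N + 1), Fin r × ℕ × ℕ → V n i), IsMonomialBasis X μ v := by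
  let β : ∀ i, Module.Basis (μ.boxes i) ℂ (V n i) := fun i =>
    (Pi.basisFun ℂ (Fin (n i))).reindex (Finite.equivFinOfCardEq (μ.card_boxes i)).symm
  let v : ∀ i : Fin (N + 1), Fin r × ℕ × ℕ → V n i := fun i b =>
    if h : b ∈ μ.boxes i then β i ⟨b, h⟩ else 0
  have hv : ∀ i (b : μ.boxes i), v i b = β i b := fun i b => dif_pos b.2
  have hv' : ∀ i, (fun b : μ.boxes i => v i b) = β i := fun i => funext (hv i)
  let X : Datum r n :=
    { B₁ := fun i => (β i).constr ℂ fun b => v i (b.1.1, b.1.2.1 + 1, b.1.2.2)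
      B₂ := fun i => (β i).constr ℂ fun b => v i (b.1.1, b.1.2.1, b.1.2.2 + 1)
      I := (Pi.basisFun ℂ (Fin r)).constr ℂ fun a => v 0 (a, 0, 0)
      J := 0
      F := fun i => (β i.succ).constr ℂ fun b => v i.castSucc b
      G := 0 }
  refine ⟨X, v, ?_, ?_, ?_, ?_, ?_, ?_, rfl, ?_, fun _ => rfl⟩
  · intro i
    rw [hv']
    exact (β i).linearIndependent
  · intro i
    rw [Set.image_eq_range, hv', (β i).span_eq]
  · exact fun i b hb => dif_neg hb
  · intro i a k l hb
    exact (congrArg (X.B₁ i) (hv i ⟨_, hb⟩)).trans ((β i).constr_basis ℂ _ _)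
  · intro i a k l hb
    exact (congrArg (X.B₂ i) (hv i ⟨_, hb⟩)).trans ((β i).constr_basis ℂ _ _)
  · intro a
    rw [← Pi.basisFun_apply]
    exact (Pi.basisFun ℂ (Fin r)).constr_basis ℂ _ _
  · intro i b hb
    exact (congrArg (X.F i) (hv i.succ ⟨_, hb⟩)).trans ((β i.succ).constr_basis ℂ _ _)

/-! ### Subspaces invariant under an operator with simple spectrum -/

/-- If the eigenvectors `x i` of `f`, with pairwise distinct eigenvalues, span the space, then an
`f`-invariant subspace is spanned by those `x i` which it contains: the projections to the
eigenlines are polynomials in `f`. -/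
theorem le_span_eigenvectors_of_invariant {K M ι : Type*} [Field K] [AddCommGroup M] [Module K M]
    (f : Module.End K M) {w : ι → K} (hw : Function.Injective w) {x : ι → M}
    (hx : ∀ i, f (x i) = w i • x i) (hspan : Submodule.span K (Set.range x) = ⊤)
    {S : Submodule K M} (hS : S ≤ S.comap f) :
    S ≤ Submodule.span K (x '' {i | x i ≠ 0 ∧ x i ∈ S}) := by
  classical
  have haeval : ∀ (p : Polynomial K) i, Polynomial.aeval f p (x i) = p.eval (w i) • x i := by
    intro p i
    by_cases h0 : x i = 0
    · simp [h0]
    · exact Module.End.aeval_apply_of_hasEigenvector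
        ⟨Module.End.mem_eigenspace_iff.2 (hx i), h0⟩
  intro y hy
  obtain ⟨c, hc⟩ := Finsupp.mem_span_range_iff_exists_finsupp.1
    (hspan ▸ Submodule.mem_top : y ∈ Submodule.span K (Set.range x))
  have hterm : ∀ i ∈ c.support, c i • x i ∈ S := by
    intro i hi
    have h : Polynomial.aeval f (Lagrange.basis c.support w i) y = c i • x i := by
      rw [← hc, Finsupp.sum, map_sum, Finset.sum_eq_single_of_mem i hi]
      · rw [map_smul, haeval, Lagrange.eval_basis_self hw.injOn hi, one_smul]
      · intro j hj hji
        rw [map_smul, haeval, Lagrange.eval_basis_of_ne hji.symm hj, zero_smul, smul_zero]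
    rw [← h]
    exact Polynomial.aeval_apply_smul_mem_of_le_comap hy _ f hS
  rw [← hc]
  refine Submodule.sum_mem _ fun i hi => ?_
  by_cases h0 : x i = 0
  · simp [h0]
  · exact Submodule.smul_mem _ _ (Submodule.subset_span ⟨i, ⟨h0,
      (S.smul_mem_iff (Finsupp.mem_support_iff.1 hi)).1 (hterm i hi)⟩, rfl⟩)

/-! ### Monomials of a datum with commuting operators on `V_0` -/

namespace Datum

variable {X : Datum r n}

theorem monomial_zero (X : Datum r n) (a : Fin r) :
    X.monomial (a, 0, 0) = X.I (Pi.single a 1) := by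
  simp [monomial]

theorem B₁_monomial (X : Datum r n) (a : Fin r) (k l : ℕ) :
    X.B₁ 0 (X.monomial (a, k, l)) = X.monomial (a, k + 1, l) := by
  simp [monomial, pow_succ']

theorem B₂_monomial (h : Commute (X.B₁ 0) (X.B₂ 0)) (a : Fin r) (k l : ℕ) :
    X.B₂ 0 (X.monomial (a, k, l)) = X.monomial (a, k, l + 1) := by
  have e := fun x => LinearMap.congr_fun ((h.pow_left k).eq) x
  simp only [Module.End.mul_apply] at e
  simp [monomial, pow_succ', e]

theorem monomial_mem_of_le (h : Commute (X.B₁ 0) (X.B₂ 0)) {S : Submodule ℂ (V n 0)}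
    (h₁ : ∀ x ∈ S, X.B₁ 0 x ∈ S) (h₂ : ∀ x ∈ S, X.B₂ 0 x ∈ S) {a : Fin r} {k l k' l' : ℕ}
    (hk : k ≤ k') (hl : l ≤ l') (hb : X.monomial (a, k, l) ∈ S) : X.monomial (a, k', l') ∈ S := by
  induction hk with
  | refl =>
    induction hl with
    | refl => exact hb
    | step _ ih => exact B₂_monomial h a _ _ ▸ h₂ _ ih
  | step _ ih => exact B₁_monomial X a _ _ ▸ h₁ _ ih

theorem IsStable.span_monomial (hst : X.IsStable) (h : Commute (X.B₁ 0) (X.B₂ 0)) :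
    Submodule.span ℂ (Set.range X.monomial) = ⊤ := by
  apply hst.adhm_stable
  · rw [LinearMap.range_eq_map, ← (Pi.basisFun ℂ (Fin r)).span_eq, Submodule.map_span]
    refine Submodule.span_mono ?_
    rintro _ ⟨_, ⟨a, rfl⟩, rfl⟩
    exact ⟨(a, 0, 0), by rw [monomial_zero, Pi.basisFun_apply]⟩
  · rw [Submodule.map_span]
    refine Submodule.span_mono ?_
    rintro _ ⟨_, ⟨⟨a, k, l⟩, rfl⟩, rfl⟩
    exact ⟨_, (B₁_monomial X a k l).symm⟩
  · rw [Submodule.map_span]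
    refine Submodule.span_mono ?_
    rintro _ ⟨_, ⟨⟨a, k, l⟩, rfl⟩, rfl⟩
    exact ⟨_, (B₂_monomial h a k l).symm⟩

/-- The boxes whose monomial vector is nonzero and lies in the image of `V_i` in `V_0`. -/
def monomialBoxes (X : Datum r n) (i : Fin (N + 1)) : Set (Fin r × ℕ × ℕ) :=
  {b | X.monomial b ≠ 0 ∧ X.monomial b ∈ LinearMap.range (X.toZero i)}

theorem monomialBoxes_antitone : Antitone X.monomialBoxes := by
  have h : Antitone fun i => LinearMap.range (X.toZero i) :=
    Fin.antitone_iff_succ_le.2 fun i => LinearMap.range_comp_le_range _ _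
  exact fun i j hij b hb => ⟨hb.1, h hij hb.2⟩

open Classical in
/-- The vector of `V_i` which maps to the monomial vector of `b` in `V_0`, if there is one, and
zero otherwise. -/
noncomputable def monomialLift (X : Datum r n) (i : Fin (N + 1)) (b : Fin r × ℕ × ℕ) : V n i :=
  if h : X.monomial b ∈ LinearMap.range (X.toZero i) then h.choose else 0

theorem toZero_monomialLift {i : Fin (N + 1)} {b : Fin r × ℕ × ℕ}
    (h : X.monomial b ∈ LinearMap.range (X.toZero i)) :
    X.toZero i (X.monomialLift i b) = X.monomial b := by
  rw [monomialLift, dif_pos h]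
  exact h.choose_spec

theorem monomialLift_zero (b : Fin r × ℕ × ℕ) : X.monomialLift 0 b = X.monomial b :=
  toZero_monomialLift (i := 0) (⟨_, rfl⟩ : X.monomial b ∈ LinearMap.range LinearMap.id)

theorem IsStable.monomialLift_eq_zero (hst : X.IsStable) {i : Fin (N + 1)} {b : Fin r × ℕ × ℕ}
    (hb : b ∉ X.monomialBoxes i) : X.monomialLift i b = 0 := by
  by_cases h : X.monomial b ∈ LinearMap.range (X.toZero i)
  · have h0 : X.monomial b = 0 := by
      by_contra h0
      exact hb ⟨h0, h⟩
    exact hst.toZero_injective i (by rw [toZero_monomialLift h, h0, map_zero])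
  · rw [monomialLift, dif_neg h]

end Datum

/-! ### Fixed points have monomial bases -/

section Fixed

variable {X : Datum r n} {g : Gauge n} {t : Torus r}

/-- If `g` undoes the action of `t` on `X`, then `I w_a` is an eigenvector of `g` on `V_0` of
eigenvalue `e_a`. -/
theorem map_I_of_fixed (hg : g • t • X = X) (a : Fin r) :
    g 0 (X.I (Pi.single a 1)) = t.2.2 a • X.I (Pi.single a 1) := by
  have e : diagW t.2.2⁻¹ (t.2.2 a • Pi.single a (1 : ℂ)) = Pi.single a 1 := by
    funext c
    by_cases hc : c = a
    · subst hc; simp [diagW, Units.smul_def]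
    · simp [diagW, hc, Units.smul_def]
  have h := map_I_of_smul_eq hg (t.2.2 a • Pi.single a (1 : ℂ))
  rw [torus_smul_def, torusAct, LinearMap.comp_apply, e] at h
  rw [h, Units.smul_def, map_smul, Units.smul_def]

/-- `B₁` divides weights by `t₁`. -/
theorem map_B₁_of_fixed (hg : g • t • X = X) {x : V n 0} {a : Fin r} {k l : ℕ}
    (hx : g 0 x = boxWeight t (a, k, l) • x) :
    g 0 (X.B₁ 0 x) = boxWeight t (a, k + 1, l) • X.B₁ 0 x := by
  have e : boxWeight t (a, k + 1, l) = t.1⁻¹ * boxWeight t (a, k, l) := by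
    simp only [boxWeight, pow_succ, mul_inv]
    ac_rfl
  have h := map_B₁_of_smul_eq hg 0 x
  simp only [torus_smul_def, torusAct, LinearMap.smul_apply, map_smul, hx, Units.smul_def] at h
  rw [e, mul_smul, eq_inv_smul_iff, Units.smul_def, Units.smul_def, h]

/-- `B₂` divides weights by `t₂`. -/
theorem map_B₂_of_fixed (hg : g • t • X = X) {x : V n 0} {a : Fin r} {k l : ℕ}
    (hx : g 0 x = boxWeight t (a, k, l) • x) :
    g 0 (X.B₂ 0 x) = boxWeight t (a, k, l + 1) • X.B₂ 0 x := by
  have e : boxWeight t (a, k, l + 1) = t.2.1⁻¹ * boxWeight t (a, k, l) := by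
    simp only [boxWeight, pow_succ', mul_inv]
    exact mul_left_comm _ _ _
  have h := map_B₂_of_smul_eq hg 0 x
  simp only [torus_smul_def, torusAct, LinearMap.smul_apply, map_smul, hx, Units.smul_def] at h
  rw [e, mul_smul, eq_inv_smul_iff, Units.smul_def, Units.smul_def, h]

/-- `V_0` is spanned by vectors of weights `e_a t₁^{-k} t₂^{-l}`, while `J` can only be nonzero
on vectors of weight `e_c t₁ t₂`. Commutativity of `B₁` and `B₂` on `V_0` is not available here,
so the span of all such weight vectors is used instead of the span of monomials. -/
theorem J_eq_zero_of_fixed (hst : X.IsStable) (hg : g • t • X = X)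
    (ht : ∀ (c : Fin r) b, t.1 * t.2.1 * t.2.2 c ≠ boxWeight t b) : X.J = 0 := by
  let S : Submodule ℂ (V n 0) := Submodule.span ℂ {x | ∃ b, g 0 x = boxWeight t b • x}
  have hS : S = ⊤ := by
    apply hst.adhm_stable
    · rw [LinearMap.range_eq_map, ← (Pi.basisFun ℂ (Fin r)).span_eq, Submodule.map_span]
      refine Submodule.span_mono ?_
      rintro _ ⟨_, ⟨a, rfl⟩, rfl⟩
      refine ⟨(a, 0, 0), ?_⟩
      rw [Pi.basisFun_apply, map_I_of_fixed hg]
      simp [boxWeight]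
    · rw [Submodule.map_span]
      refine Submodule.span_mono ?_
      rintro _ ⟨x, ⟨⟨a, k, l⟩, hx⟩, rfl⟩
      exact ⟨_, map_B₁_of_fixed hg hx⟩
    · rw [Submodule.map_span]
      refine Submodule.span_mono ?_
      rintro _ ⟨x, ⟨⟨a, k, l⟩, hx⟩, rfl⟩
      exact ⟨_, map_B₂_of_fixed hg hx⟩
  refine LinearMap.ext_on hS ?_
  rintro x ⟨b, hx⟩
  funext c
  have h := congrFun (map_J_of_smul_eq hg x) c
  rw [hx, Units.smul_def, map_smul] at h
  simp only [torus_smul_def, torusAct, diagW, LinearMap.smul_apply, LinearMap.comp_apply,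
    LinearMap.pi_apply, LinearMap.proj_apply, Pi.smul_apply, smul_eq_mul] at h
  rw [← mul_assoc] at h
  by_contra h0
  exact ht c b (Units.ext (mul_right_cancel₀ h0 h))

theorem map_monomial_of_fixed (hg : g • t • X = X) (hc : Commute (X.B₁ 0) (X.B₂ 0))
    (b : Fin r × ℕ × ℕ) : g 0 (X.monomial b) = boxWeight t b • X.monomial b := by
  obtain ⟨a, k, l⟩ := b
  induction k with
  | zero =>
    induction l with
    | zero =>
      rw [Datum.monomial_zero, map_I_of_fixed hg]
      simp [boxWeight]
    | succ l ih =>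
      rw [← Datum.B₂_monomial hc]
      exact map_B₂_of_fixed hg ih
  | succ k ih =>
    rw [← Datum.B₁_monomial]
    exact map_B₁_of_fixed hg ih

theorem map_toZero_of_fixed (hg : g • t • X = X) (i : Fin (N + 1)) (x : V n i) :
    g 0 (X.toZero i x) = X.toZero i (g i x) := by
  induction i using Fin.induction with
  | zero => rfl
  | succ i ih =>
    rw [Datum.toZero_succ, LinearMap.comp_apply, LinearMap.comp_apply, ih,
      ← map_F_of_smul_eq hg]
    rfl

/-- A stable representation whose orbit is fixed by one sufficiently generic `t` has a monomial
basis: the monomials are eigenvectors of `g` on `V_0` with distinct eigenvalues, and the images of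
the `V_i` in `V_0` are invariant, hence spanned by monomials. -/
theorem exists_isMonomialBasis_of_fixed (hrel : X.SatisfiesRelations) (hst : X.IsStable)
    (hg : g • t • X = X) (hinj : Function.Injective (boxWeight t))
    (ht : ∀ (c : Fin r) b, t.1 * t.2.1 * t.2.2 c ≠ boxWeight t b) :
    ∃ (μ : NestedPartition r n) (v : ∀ i : Fin (N + 1), Fin r × ℕ × ℕ → V n i),
      IsMonomialBasis X μ v := by
  have hJ := J_eq_zero_of_fixed hst hg ht
  have hcomm : Commute (X.B₁ 0) (X.B₂ 0) := by
    have h := hrel.adhm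
    rw [hJ, LinearMap.comp_zero, add_zero, sub_eq_zero] at h
    exact h
  have hwt : ∀ b, (g 0).toLinearMap (X.monomial b) = (boxWeight t b : ℂ) • X.monomial b :=
    fun b => map_monomial_of_fixed hg hcomm b
  have hinj' : Function.Injective fun b : Fin r × ℕ × ℕ => (boxWeight t b : ℂ) :=
    fun b c h => hinj (Units.ext h)
  -- the images of the `V_i` in `V_0` are invariant under `B₁`, `B₂` and `g`
  have hS₁ : ∀ i, ∀ x ∈ LinearMap.range (X.toZero i), X.B₁ 0 x ∈ LinearMap.range (X.toZero i) := by
    rintro i _ ⟨x, rfl⟩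
    exact ⟨_, hrel.toZero_B₁ i x⟩
  have hS₂ : ∀ i, ∀ x ∈ LinearMap.range (X.toZero i), X.B₂ 0 x ∈ LinearMap.range (X.toZero i) := by
    rintro i _ ⟨x, rfl⟩
    exact ⟨_, hrel.toZero_B₂ i x⟩
  have hSg : ∀ i, LinearMap.range (X.toZero i) ≤
      (LinearMap.range (X.toZero i)).comap (g 0).toLinearMap := by
    rintro i _ ⟨x, rfl⟩
    exact ⟨_, (map_toZero_of_fixed hg i x).symm⟩
  have hlift : ∀ {i b}, b ∈ X.monomialBoxes i → X.toZero i (X.monomialLift i b) = X.monomial b :=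
    fun hb => Datum.toZero_monomialLift hb.2
  -- the lifts of the monomials in the image of `V_i` form a basis of `V_i`
  have hli : ∀ i, LinearIndependent ℂ fun b : X.monomialBoxes i => X.monomialLift i b := by
    intro i
    refine LinearIndependent.of_comp (X.toZero i) ?_
    have e : (X.toZero i ∘ fun b : X.monomialBoxes i => X.monomialLift i b) =
        fun b : X.monomialBoxes i => X.monomial b := funext fun b => hlift b.2
    rw [e]
    exact Module.End.eigenvectors_linearIndependent' (g 0).toLinearMap
      (fun b : X.monomialBoxes i => (boxWeight t b : ℂ)) (hinj'.comp Subtype.val_injective) _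
      fun b => ⟨Module.End.mem_eigenspace_iff.2 (hwt b), b.2.1⟩
  have hspan : ∀ i, Submodule.span ℂ (X.monomialLift i '' X.monomialBoxes i) = ⊤ := by
    intro i
    refine Submodule.map_injective_of_injective (hst.toZero_injective i) ?_
    rw [Submodule.map_top]
    refine le_antisymm LinearMap.map_le_range ?_
    rw [Submodule.map_span, Set.image_image, Set.image_congr fun b hb => hlift hb]
    exact le_span_eigenvectors_of_invariant _ hinj' hwt (hst.span_monomial hcomm) (hSg i)
  have hfin : ∀ i, (X.monomialBoxes i).Finite := fun i => Set.finite_coe_iff.1 (hli i).finite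
  have hcard : ∀ i, (X.monomialBoxes i).ncard = n i := by
    intro i
    rw [← Nat.card_coe_set_eq, ← Module.finrank_eq_nat_card_basis
      (Module.Basis.mk (hli i) (by rw [← Set.image_eq_range, hspan i])), Module.finrank_fin_fun]
  -- the monomials divisible by a vanishing one vanish, and those divisible by one in the image
  -- of `V_i` lie in that image
  have hlow : ∀ a k l k' l', k ≤ k' → l ≤ l' →
      (a, k', l') ∈ X.monomialBoxes 0 → (a, k, l) ∈ X.monomialBoxes 0 := by
    rintro a k l k' l' hk hl ⟨h0, -⟩
    refine ⟨fun h => h0 ?_, by simp⟩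
    exact (Submodule.mem_bot ℂ).1 (Datum.monomial_mem_of_le hcomm (S := ⊥) (by simp) (by simp)
      hk hl ((Submodule.mem_bot ℂ).2 h))
  have hup : ∀ i a k l k' l', k ≤ k' → l ≤ l' → (a, k, l) ∈ X.monomialBoxes i →
      (a, k', l') ∈ X.monomialBoxes 0 → (a, k', l') ∈ X.monomialBoxes i :=
    fun i a k l k' l' hk hl hb h0 =>
      ⟨h0.1, Datum.monomial_mem_of_le hcomm (hS₁ i) (hS₂ i) hk hl hb.2⟩
  obtain ⟨μ, hμ⟩ := NestedPartition.exists_boxes_eq Datum.monomialBoxes_antitone hfin hlow hup hcard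
  refine ⟨μ, X.monomialLift, ?_, ?_, ?_, ?_, ?_, ?_, hJ, ?_, ?_⟩
  · intro i
    rw [hμ]
    exact hli i
  · intro i
    rw [hμ, hspan]
  · intro i b hb
    rw [hμ] at hb
    exact hst.monomialLift_eq_zero hb
  · intro i a k l hb
    rw [hμ] at hb
    refine hst.toZero_injective i ?_
    rw [hrel.toZero_B₁, hlift hb, Datum.B₁_monomial, Datum.toZero_monomialLift]
    exact Datum.B₁_monomial X a k l ▸ hS₁ i _ hb.2
  · intro i a k l hb
    rw [hμ] at hb
    refine hst.toZero_injective i ?_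
    rw [hrel.toZero_B₂, hlift hb, Datum.B₂_monomial hcomm, Datum.toZero_monomialLift]
    exact Datum.B₂_monomial hcomm a k l ▸ hS₂ i _ hb.2
  · intro a
    rw [Datum.monomialLift_zero, Datum.monomial_zero]
  · intro i b hb
    rw [hμ] at hb
    refine hst.toZero_injective i.castSucc ?_
    rw [← LinearMap.comp_apply, ← Datum.toZero_succ, hlift hb,
      hlift (Datum.monomialBoxes_antitone i.castSucc_lt_succ.le hb)]
  · intro i
    -- `F G = 0` with `F` injective
    refine LinearMap.ext fun x => hst.injective i ?_
    rw [LinearMap.zero_apply, map_zero]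
    exact LinearMap.congr_fun (hrel.FG i) x

end Fixed

/-! ### A generic element of the torus -/

variable (r) in
/-- The element `(2, 3, (5^a)_a)` of the torus. By unique factorization its values under the
characters `e_a t₁^{-k} t₂^{-l}` are pairwise distinct and none of them is of the form
`e_c t₁ t₂`. -/
noncomputable def genericTorusElement : Torus r :=
  (Units.mk0 2 two_ne_zero, Units.mk0 3 three_ne_zero,
    fun a => Units.mk0 5 (OfNat.ofNat_ne_zero 5) ^ (a : ℕ))

theorem boxWeight_genericTorusElement (a : Fin r) (k l : ℕ) :
    (boxWeight (genericTorusElement r) (a, k, l) : ℂ) = 5 ^ (a : ℕ) / (2 ^ k * 3 ^ l) := by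
  simp only [boxWeight, genericTorusElement, Units.val_mul, Units.val_inv_eq_inv_val,
    Units.val_pow_eq_pow_val, Units.val_mk0]
  field_simp

theorem boxWeight_genericTorusElement_injective :
    Function.Injective (boxWeight (genericTorusElement r)) := by
  rintro ⟨a, k, l⟩ ⟨a', k', l'⟩ h
  have h1 := congrArg (Units.val) h
  rw [boxWeight_genericTorusElement, boxWeight_genericTorusElement,
    div_eq_div_iff (by simp) (by simp)] at h1
  have h2 : 5 ^ (a : ℕ) * (2 ^ k' * 3 ^ l') = 5 ^ (a' : ℕ) * (2 ^ k * 3 ^ l) := by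
    exact_mod_cast h1
  have key : ∀ (p : ℕ) [Fact p.Prime] (x y z : ℕ), padicValNat p (5 ^ x * (2 ^ y * 3 ^ z)) =
      x * padicValNat p 5 + (y * padicValNat p 2 + z * padicValNat p 3) := by
    intro p _ x y z
    rw [padicValNat.mul (by positivity) (by positivity),
      padicValNat.mul (by positivity) (by positivity), padicValNat.pow, padicValNat.pow,
      padicValNat.pow]
  have : Fact (Nat.Prime 5) := ⟨by norm_num⟩
  have e2 := congrArg (padicValNat 2) h2
  have e3 := congrArg (padicValNat 3) h2
  have e5 := congrArg (padicValNat 5) h2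
  simp only [key] at e2 e3 e5
  simp [padicValNat_primes] at e2 e3 e5
  simp only [Prod.mk.injEq]
  omega

theorem genericTorusElement_mul_ne_boxWeight (c : Fin r) (b : Fin r × ℕ × ℕ) :
    (genericTorusElement r).1 * (genericTorusElement r).2.1 * (genericTorusElement r).2.2 c ≠
      boxWeight (genericTorusElement r) b := by
  obtain ⟨a, k, l⟩ := b
  intro h
  have h1 := congrArg (Units.val) h
  rw [boxWeight_genericTorusElement, eq_div_iff (by simp)] at h1
  simp only [genericTorusElement, Units.val_mul, Units.val_pow_eq_pow_val, Units.val_mk0] at h1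
  have h2 : 2 * 3 * 5 ^ (c : ℕ) * (2 ^ k * 3 ^ l) = 5 ^ (a : ℕ) := by exact_mod_cast h1
  have h3 : 2 ∣ 5 ^ (a : ℕ) := ⟨3 * 5 ^ (c : ℕ) * (2 ^ k * 3 ^ l), by rw [← h2]; ring⟩
  have h4 := Nat.prime_two.dvd_of_dvd_pow h3
  omega

/-! ### The bijection -/

theorem ModuliSpace.mk_eq_mk_iff {X Y : StableRep r n} :
    ModuliSpace.mk X = ModuliSpace.mk Y ↔ ∃ g : Gauge n, g • X.1 = Y.1 := by
  rw [eq_comm]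
  refine Quotient.eq.trans ?_
  change (∃ g : Gauge n, g • X = Y) ↔ _
  exact exists_congr fun g => Subtype.ext_iff

theorem exists_isMonomialBasis_of_mem_fixedLocus {X : StableRep r n}
    (hX : ModuliSpace.mk X ∈ FixedLocus r n) :
    ∃ (μ : NestedPartition r n) (v : ∀ i : Fin (N + 1), Fin r × ℕ × ℕ → V n i),
      IsMonomialBasis X.1 μ v := by
  obtain ⟨g, hg⟩ := ModuliSpace.mk_eq_mk_iff.1 (hX (genericTorusElement r))
  exact exists_isMonomialBasis_of_fixed X.2.1 X.2.2 hg
    boxWeight_genericTorusElement_injective genericTorusElement_mul_ne_boxWeight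

/-- The partition does not depend on the representative of the fixed point. -/
theorem existsUnique_partition (p : FixedLocus r n) : ∃! μ : NestedPartition r n,
    ∀ X, ModuliSpace.mk X = p.1 → ∃ v, IsMonomialBasis X.1 μ v := by
  obtain ⟨X, hX⟩ : ∃ X, ModuliSpace.mk X = p.1 := Quotient.exists_rep p.1
  obtain ⟨μ, v, h⟩ := exists_isMonomialBasis_of_mem_fixedLocus (hX ▸ p.2)
  refine ⟨μ, fun Y hY => ?_, fun ν hν => ?_⟩
  · obtain ⟨g, hg⟩ := ModuliSpace.mk_eq_mk_iff.1 (hX.trans hY.symm)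
    exact ⟨_, hg ▸ h.smul g⟩
  · obtain ⟨v', h'⟩ := hν X hX
    exact h'.partition_unique h

/-- The nested coloured partition of a fixed point: the one for which all representatives have a
monomial basis. -/
noncomputable def partitionOfFixed (p : FixedLocus r n) : NestedPartition r n :=
  (existsUnique_partition p).choose

theorem exists_isMonomialBasis_partitionOfFixed {p : FixedLocus r n} {X : StableRep r n}
    (h : ModuliSpace.mk X = p.1) : ∃ v, IsMonomialBasis X.1 (partitionOfFixed p) v :=
  (existsUnique_partition p).choose_spec.1 X h

theorem partitionOfFixed_bijective : Function.Bijective (partitionOfFixed (r := r) (n := n)) := by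
  constructor
  · intro p q hpq
    obtain ⟨X, hX⟩ : ∃ X, ModuliSpace.mk X = p.1 := Quotient.exists_rep p.1
    obtain ⟨Y, hY⟩ : ∃ Y, ModuliSpace.mk Y = q.1 := Quotient.exists_rep q.1
    obtain ⟨v, h⟩ := exists_isMonomialBasis_partitionOfFixed hX
    obtain ⟨v', h'⟩ := exists_isMonomialBasis_partitionOfFixed hY
    rw [hpq] at h
    exact Subtype.ext (hX.symm.trans
      ((ModuliSpace.mk_eq_mk_iff.2 (h.exists_smul_eq h')).trans hY))
  · intro μ
    obtain ⟨X, v, h⟩ := exists_isMonomialBasis_of_partition μ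
    let Y : StableRep r n := ⟨X, h.satisfiesRelations, h.isStable⟩
    have hY : ModuliSpace.mk Y ∈ FixedLocus r n := fun t =>
      ModuliSpace.mk_eq_mk_iff.2 ⟨h.lam t, h.lam_smul_smul t⟩
    obtain ⟨v', h'⟩ := exists_isMonomialBasis_partitionOfFixed (p := ⟨_, hY⟩) (X := Y) rfl
    exact ⟨⟨_, hY⟩, h'.partition_unique h⟩

end NestedInstantons

theorem mainTheorem6 (N r : ℕ) (n : Fin (N + 1) → ℕ) :
    ∃ Φ : NestedInstantons.FixedLocus r n ≃ NestedInstantons.NestedPartition r n,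
      ∀ (X : NestedInstantons.StableRep r n)
        (hX : NestedInstantons.ModuliSpace.mk X ∈ NestedInstantons.FixedLocus r n),
        ∃ (v : ∀ i : Fin (N + 1), Fin r × ℕ × ℕ → NestedInstantons.V n i)
          (lam : NestedInstantons.Torus r →* NestedInstantons.Gauge n),
          NestedInstantons.IsMonomialBasis X.1 (Φ ⟨NestedInstantons.ModuliSpace.mk X, hX⟩) v ∧
          (∀ t : NestedInstantons.Torus r, lam t • t • X = X) ∧
          (∀ (t : NestedInstantons.Torus r) (i : Fin (N + 1)),
            ∀ b ∈ (Φ ⟨NestedInstantons.ModuliSpace.mk X, hX⟩).boxes i,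
              lam t i (v i b) = NestedInstantons.boxWeight t b • v i b) := by
  refine ⟨Equiv.ofBijective _ NestedInstantons.partitionOfFixed_bijective, fun X hX => ?_⟩
  obtain ⟨v, h⟩ := NestedInstantons.exists_isMonomialBasis_partitionOfFixed
    (p := ⟨NestedInstantons.ModuliSpace.mk X, hX⟩) (X := X) rfl
  exact ⟨v, h.lam, h, fun t => Subtype.ext (h.lam_smul_smul t), fun t i b _ => h.lam_apply t i b⟩
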